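/- All digraphs are simple: they have no loops, no multiple arcs and no circuits of length $2$. The chromatic number $\chi(D)$ of a digraph $D$ is the chromatic number of its underlying graph. For positive integers $k,l,r$, let $P(k,l,r)$ be the oriented path consisting of $k$ forward arcs, followed by $l$ backward arcs, followed by $r$ forward arcs. A digraph $D$ contains $P(k,l,r)$ if some subdigraph of $D$ (not necessarily induced) is isomorphic to it. **Theorem 3.1.** Let $n$ be a positive integer and let $k,l,r\ge 2$ be integers with $k+l+r=n-1$ and $k\le r$. Let $D$ be a digraph that does not contain $P(k,l,r)$. Then $$\chi(D)\le\begin{cases}2(n-1)+r & \text{if } l\le k\le r,\\ 2(n-1)+l+r-k & \text{if } k\le l\le r,\\ 2(n+l-1)-k & \text{if } k\le r\le l.\end{cases}$$ -/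

import Mathlib

/-- A digraph is simple if it has no loops and no circuits of length `2`. (Multiple arcs are
excluded by the type `Digraph`; the condition for `u = v` says that there are no loops.) -/
def Digraph.IsSimple {V : Type*} (D : Digraph V) : Prop :=
  ∀ u v : V, D.Adj u v → ¬ D.Adj v u

/-- `D` contains `H`: `H` is isomorphic to a (not necessarily induced) subdigraph of `D`. -/
def Digraph.Contains {V W : Type*} (D : Digraph V) (H : Digraph W) : Prop :=
  ∃ f : W → V, Function.Injective f ∧ ∀ a b : W, H.Adj a b → D.Adj (f a) (f b)

/-- The chromatic number of a digraph is that of its underlying graph: two distinct vertices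
are adjacent there when there is an arc between them in at least one direction. -/
noncomputable def Digraph.chromaticNumber {V : Type*} (D : Digraph V) : ℕ∞ :=
  D.toSimpleGraphInclusive.chromaticNumber

/-- The oriented path `P(k, l, r)` on the vertices `0, 1, …, k + l + r`: the edge joining `i` and
`i + 1` is a forward arc `(i, i + 1)` if it is one of the first `k` or of the last `r` edges, and a
backward arc `(i + 1, i)` if it is one of the `l` edges in between. -/
def threeBlockPath (k l r : ℕ) : Digraph (Fin (k + l + r + 1)) where
  Adj a b :=
    (b.val = a.val + 1 ∧ (a.val < k ∨ k + l ≤ a.val)) ∨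
    (a.val = b.val + 1 ∧ k ≤ b.val ∧ b.val < k + l)

namespace OrientedPath

open Function

variable {V : Type*}

/-! All three bounds are at least `2 * (n - 1) + 1`, and that many colours always suffice. By
Gallai–Roy, a maximal set `Y` without directed paths of `k + r - 1` arcs needs at most `k + r - 1`
colours. By maximality, a vertex outside `Y` ends a `k`-arc path or starts an `r`-arc path through
`Y`. This splits the rest into `Xin` and `Xout`. Each omits a two-block path, which `Y` would extend
to `P(k, l, r)`, so `l + k + 1` colours suffice for `Xout` and `l + r + 1` for `Xin`.

Both colouring lemmas use the levels of a spanning out-forest with maximal level sum: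
`exists_maximal_levelForest` makes adjacent vertices differ in level. -/

/-- A spanning out-forest of the relation `R`, given by a parent map `p` and a level map `f`:
the roots are the vertices of level `0`. -/
def IsLevelForest (R : V → V → Prop) (p : V → V) (f : V → ℕ) : Prop :=
  ∀ v, f v = 0 ∨ (R (p v) v ∧ f v = f (p v) + 1)

/-- `γ 0, …, γ m` is a directed path with `m` arcs. -/
def IsDipath (R : V → V → Prop) (γ : ℕ → V) (m : ℕ) : Prop :=
  (∀ i < m, R (γ i) (γ (i + 1))) ∧ ∀ i ≤ m, ∀ j ≤ m, γ i = γ j → i = j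

/-- Two directed paths `α` and `β` with `k` and `l` arcs, listed backwards, which end in the same
vertex `α 0 = β 0` and are otherwise disjoint. -/
def IsSinkPair (R : V → V → Prop) (α β : ℕ → V) (k l : ℕ) : Prop :=
  IsDipath (flip R) α k ∧ IsDipath (flip R) β l ∧ α 0 = β 0 ∧
    ∀ i ≤ k, ∀ j ≤ l, 1 ≤ j → α i ≠ β j

/-- The subdigraph induced on `S` has a proper colouring with the colours `0, …, m - 1`. -/
def ColorableOn (R : V → V → Prop) (S : Set V) (m : ℕ) : Prop :=
  ∃ c : V → ℕ, (∀ v ∈ S, c v < m) ∧ ∀ x ∈ S, ∀ y ∈ S, R x y → c x ≠ c y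

theorem ColorableOn.union {R : V → V → Prop} {S T : Set V} {a b : ℕ}
    (hS : ColorableOn R S a) (hT : ColorableOn R T b) : ColorableOn R (S ∪ T) (a + b) := by
  classical
  obtain ⟨c, hc, hc'⟩ := hS
  obtain ⟨d, hd, hd'⟩ := hT
  refine ⟨fun v => if v ∈ S then c v else a + d v, ?_, ?_⟩
  · intro v hv
    by_cases h : v ∈ S
    · have := hc v h
      simp only [h, if_true]
      omega
    · have := hd v (hv.resolve_left h)
      simp only [h, if_false]
      omega
  · intro x hx y hy hxy
    by_cases h : x ∈ S <;> by_cases h' : y ∈ S <;> simp only [h, h', if_true, if_false]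
    · exact hc' x h y h' hxy
    · have := hc x h
      omega
    · have := hc y h'
      omega
    · have := hd' x (hx.resolve_left h) y (hy.resolve_left h') hxy
      omega

theorem ColorableOn.of_subtype {R : V → V → Prop} {S : Set V} {m : ℕ}
    (h : ColorableOn (fun x y : S => R x y) Set.univ m) : ColorableOn R S m := by
  classical
  obtain ⟨c, hc, hc'⟩ := h
  refine ⟨fun v => if h : v ∈ S then c ⟨v, h⟩ else 0, ?_, ?_⟩
  · intro v hv
    simpa [hv] using hc ⟨v, hv⟩ trivial
  · intro x hx y hy hxy
    simpa [hx, hy] using hc' ⟨x, hx⟩ trivial ⟨y, hy⟩ trivial hxy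

theorem ColorableOn.of_flip {R : V → V → Prop} {S : Set V} {m : ℕ}
    (h : ColorableOn (flip R) S m) : ColorableOn R S m := by
  obtain ⟨c, hc, hc'⟩ := h
  exact ⟨c, hc, fun x hx y hy hxy => (hc' y hy x hx hxy).symm⟩

theorem IsDipath.map_val {R : V → V → Prop} {S : Set V} {γ : ℕ → S} {m : ℕ}
    (h : IsDipath (fun x y : S => R x y) γ m) : IsDipath R (fun i => (γ i : V)) m :=
  ⟨h.1, fun i hi j hj hij => h.2 i hi j hj (Subtype.ext hij)⟩

theorem IsDipath.shift {R : V → V → Prop} {γ : ℕ → V} {m n i : ℕ} (h : IsDipath R γ n)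
    (hmn : i + m ≤ n) : IsDipath R (fun j => γ (i + j)) m := by
  refine ⟨fun j hj => h.1 (i + j) (by omega), fun a ha b hb hab => ?_⟩
  have := h.2 (i + a) (by omega) (i + b) (by omega) hab
  omega

theorem IsDipath.reverse {R : V → V → Prop} {γ : ℕ → V} {m n i : ℕ} (h : IsDipath R γ n)
    (hi : i ≤ n) (hm : m ≤ i) : IsDipath (flip R) (fun j => γ (i - j)) m := by
  refine ⟨fun j hj => ?_, fun a ha b hb hab => ?_⟩
  · have := h.1 (i - (j + 1)) (by omega)
    rwa [show i - (j + 1) + 1 = i - j by omega] at this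
  · have := h.2 (i - a) (by omega) (i - b) (by omega) hab
    omega

/-! ### Levels and ancestors in an out-forest -/

namespace IsLevelForest

variable {R : V → V → Prop} {p : V → V} {f : V → ℕ}

theorem level_iterate (h : IsLevelForest R p f) (v : V) (i : ℕ) (hi : i ≤ f v) :
    f (p^[i] v) + i = f v := by
  induction i with
  | zero => simp
  | succ i ih =>
    have h1 := ih (by omega)
    rw [iterate_succ_apply']
    rcases h (p^[i] v) with h0 | ⟨-, h2⟩ <;> omega

theorem arc_iterate (h : IsLevelForest R p f) (v : V) (i : ℕ) (hi : i < f v) :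
    R (p^[i + 1] v) (p^[i] v) := by
  have h1 := h.level_iterate v i hi.le
  rw [iterate_succ_apply']
  rcases h (p^[i] v) with h0 | ⟨h2, -⟩
  · omega
  · exact h2

theorem isDipath (h : IsLevelForest R p f) (v : V) {m : ℕ} (hm : m ≤ f v) :
    IsDipath (flip R) (fun i => p^[i] v) m := by
  refine ⟨fun i hi => h.arc_iterate v i (by omega), fun i hi j hj hij => ?_⟩
  have h1 := h.level_iterate v i (by omega)
  have h2 := h.level_iterate v j (by omega)
  have h3 : f (p^[i] v) = f (p^[j] v) := congrArg f hij
  omega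

/-- The ancestors of `v` are distinct, their levels being distinct. This bounds level sums, so a
maximal forest exists. -/
theorem level_lt_card [Finite V] (h : IsLevelForest R p f) (v : V) : f v < Nat.card V := by
  have hinj : Injective (fun i : Fin (f v + 1) => p^[i.val] v) := fun i j hij =>
    Fin.ext ((h.isDipath v le_rfl).2 i (by omega) j (by omega) hij)
  have := Nat.card_le_card_of_injective _ hinj
  simp only [Nat.card_eq_fintype_card (α := Fin _), Fintype.card_fin] at this
  omega

/-- Hanging the subtree of `y` below `x` raises the levels in that subtree. -/
theorem exists_reparent (h : IsLevelForest R p f) {x y : V} (hxy : R x y) (hle : f y ≤ f x)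
    (hanc : ¬ ∃ i, p^[i] x = y ∧ f x = f y + i) :
    ∃ p' f', IsLevelForest R p' f' ∧ (∀ v, f v ≤ f' v) ∧ f y < f' y := by
  classical
  -- The level equation rules out iterates that run past a root, where `p` is arbitrary.
  let Desc : V → Prop := fun v => ∃ i, p^[i] v = y ∧ f v = f y + i
  have hy : Desc y := ⟨0, rfl, rfl⟩
  refine ⟨fun v => if v = y then x else p v,
    fun v => if Desc v then f v + (f x + 1 - f y) else f v, ?_, ?_, ?_⟩
  · intro v
    by_cases hvy : v = y
    · right
      subst hvy
      have hx : ¬ Desc x := hanc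
      simp only [if_true, hx, hy, if_false]
      exact ⟨hxy, by omega⟩
    · simp only [hvy, if_false]
      rcases h v with h0 | ⟨h1, h2⟩
      · left
        have hv : ¬ Desc v := by
          rintro ⟨i, hi, hfi⟩
          have : i = 0 := by omega
          subst this
          exact hvy hi
        simp only [hv, if_false, h0]
      · right
        refine ⟨h1, ?_⟩
        have hiff : Desc v ↔ Desc (p v) := by
          constructor
          · rintro ⟨i, hi, hfi⟩
            rcases i with _ | i
            · exact absurd hi hvy
            · exact ⟨i, by rwa [iterate_succ_apply] at hi, by omega⟩
          · rintro ⟨i, hi, hfi⟩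
            exact ⟨i + 1, by rwa [iterate_succ_apply], by omega⟩
        by_cases hv : Desc v
        · simp only [hv, hiff.1 hv, if_true]
          omega
        · have hv' : ¬ Desc (p v) := fun hd => hv (hiff.2 hd)
          simp only [hv, hv', if_false]
          exact h2
  · intro v
    dsimp only
    split_ifs <;> omega
  · simp only [hy, if_true]
    omega

end IsLevelForest

/-- A spanning out-forest with the largest sum of levels: an arc either goes to a higher level or
goes to an ancestor of its tail. -/
theorem exists_maximal_levelForest [Finite V] (R : V → V → Prop) :
    ∃ p f, IsLevelForest R p f ∧
      ∀ x y, R x y → f x < f y ∨ ∃ i, p^[i] x = y ∧ f x = f y + i := by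
  classical
  have := Fintype.ofFinite V
  let A : Set ℕ := {s | ∃ p f, IsLevelForest R p f ∧ ∑ v, f v = s}
  have hne : A.Nonempty := ⟨_, id, fun _ => 0, fun v => Or.inl rfl, rfl⟩
  have hbdd : BddAbove A := by
    refine ⟨∑ _v : V, Nat.card V, ?_⟩
    rintro s ⟨p, f, hf, rfl⟩
    exact Finset.sum_le_sum fun v _ => (hf.level_lt_card v).le
  obtain ⟨p, f, hf, hs⟩ := Nat.sSup_mem hne hbdd
  refine ⟨p, f, hf, fun x y hxy => ?_⟩
  by_contra! hcon
  obtain ⟨p', f', hf', hle, hlt⟩ := hf.exists_reparent hxy hcon.1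
    (by rintro ⟨i, hi, hi'⟩; exact hcon.2 i hi hi')
  have h1 : ∑ v, f v < ∑ v, f' v :=
    Finset.sum_lt_sum (fun v _ => hle v) ⟨y, Finset.mem_univ y, hlt⟩
  have h2 : ∑ v, f' v ≤ sSup A := le_csSup hbdd ⟨p', f', hf', rfl⟩
  omega

/-! ### Colourings from maximal forests -/

/-- The Gallai–Roy theorem. -/
theorem colorableOn_or_exists_isDipath [Finite V] {R : V → V → Prop} (hR : ∀ x, ¬ R x x)
    (S : Set V) (m : ℕ) :
    ColorableOn R S m ∨ ∃ γ, IsDipath R γ m ∧ ∀ i ≤ m, γ i ∈ S := by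
  obtain ⟨p, f, hf, hmax⟩ := exists_maximal_levelForest (fun x y : S => R x y)
  by_cases h : ∃ v, m ≤ f v
  · right
    obtain ⟨v, hv⟩ := h
    exact ⟨_, ((hf.isDipath v hv).reverse le_rfl le_rfl).map_val, fun i _ => Subtype.coe_prop _⟩
  · left
    push Not at h
    refine ColorableOn.of_subtype ⟨f, fun v _ => h v, fun x _ y _ hxy hfxy => ?_⟩
    rcases hmax x y hxy with h1 | ⟨i, hi, hfi⟩
    · omega
    · have : i = 0 := by omega
      subst this
      exact hR y (by simpa [show x = y from hi] using hxy)

/-- A digraph without the path consisting of a block of `k` forward arcs and a block of `l`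
backward arcs is `(l + (k + 1))`-colourable. -/
theorem colorableOn_or_exists_isSinkPair [Finite V] {R : V → V → Prop} (hR : ∀ x, ¬ R x x)
    (S : Set V) {k l : ℕ} (hk : 1 ≤ k) (hl : 1 ≤ l) :
    ColorableOn R S (l + (k + 1)) ∨
      ∃ α β, IsSinkPair R α β k l ∧ (∀ i ≤ k, α i ∈ S) ∧ ∀ i ≤ l, β i ∈ S := by
  obtain ⟨p, f, hf, hmax⟩ := exists_maximal_levelForest (fun x y : S => R x y)
  refine or_iff_not_imp_left.2 fun hcol => ?_
  suffices h : ∃ α β, IsSinkPair (fun x y : S => R x y) α β k l by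
    obtain ⟨α, β, h1, h2, h3, h4⟩ := h
    exact ⟨fun i => α i, fun i => β i,
      ⟨h1.map_val (R := flip R), h2.map_val (R := flip R), congrArg _ h3,
        fun i hi j hj hj' hij => h4 i hi j hj hj' (Subtype.ext hij)⟩,
      fun i _ => Subtype.coe_prop _, fun i _ => Subtype.coe_prop _⟩
  by_contra hno
  -- Levels below `l` get private colours and higher ones repeat with period `k + 1`. Adjacent
  -- vertices of equal colour thus have `l` ancestors each and levels at least `k + 1` apart.
  refine hcol (ColorableOn.of_subtype
    ⟨fun v => if f v < l then f v else l + (f v - l) % (k + 1), ?_, ?_⟩)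
  · intro v _
    have := Nat.mod_lt (f v - l) (by omega : k + 1 > 0)
    dsimp only
    split_ifs <;> omega
  intro x _ y _ hxy hcxy
  have hne : f x ≠ f y := by
    intro hfxy
    rcases hmax x y hxy with h1 | ⟨i, hi, hfi⟩
    · omega
    · have : i = 0 := by omega
      subst this
      exact hR y (by simpa [show x = y from hi] using hxy)
  have key : l ≤ f x ∧ l ≤ f y ∧ (f x + (k + 1) ≤ f y ∨ f y + (k + 1) ≤ f x) := by
    dsimp only at hcxy
    split_ifs at hcxy with h1 h2 h2
    · omega
    · omega
    · omega
    · refine ⟨by omega, by omega, ?_⟩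
      have hmod : (f x - l) % (k + 1) = (f y - l) % (k + 1) := by omega
      rcases lt_or_gt_of_ne hne with hlt | hlt
      · left
        have := Nat.le_of_dvd (by omega) ((Nat.modEq_iff_dvd' (by omega)).1 hmod)
        omega
      · right
        have := Nat.le_of_dvd (by omega) ((Nat.modEq_iff_dvd' (by omega)).1 hmod.symm)
        omega
  obtain ⟨hlx, hly, hfar⟩ := key
  -- The path that enters `y` from `x` and follows the ancestors of `x` backwards.
  have hcons : ∀ m, m ≤ f x → (∀ i ≤ m, f (p^[i] x) ≠ f y) →
      IsDipath (flip fun x y : S => R x y) (fun i => if i = 0 then y else p^[i - 1] x) (m + 1) := by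
    intro m hm hyp
    refine ⟨fun i hi => ?_, fun i hi j hj hij => ?_⟩
    · rcases i with _ | i
      · exact hxy
      · simpa using (hf.isDipath x hm).1 i (by omega)
    · rcases i with _ | i <;> rcases j with _ | j
      · rfl
      · simp only [if_true, Nat.succ_ne_zero, if_false, Nat.add_sub_cancel] at hij
        exact absurd (congrArg f hij).symm (hyp j (by omega))
      · simp only [if_true, Nat.succ_ne_zero, if_false, Nat.add_sub_cancel] at hij
        exact absurd (congrArg f hij) (hyp i (by omega))
      · simp only [Nat.succ_ne_zero, if_false, Nat.add_sub_cancel] at hij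
        rw [(hf.isDipath x hm).2 i (by omega) j (by omega) hij]
  rcases hfar with hfar | hfar
  -- The `k` nearest ancestors of `y` still lie above the level of `x`.
  · refine hno ⟨fun i => p^[i] y, fun i => if i = 0 then y else p^[i - 1] x,
      hf.isDipath y (by omega), ?_, by simp, ?_⟩
    · have := hcons (l - 1) (by omega) (fun i hi => by
        have := hf.level_iterate x i (by omega)
        omega)
      rwa [Nat.sub_add_cancel hl] at this
    · intro i hi j hj hj' hij
      simp only [show j ≠ 0 by omega, if_false] at hij
      have h1 := hf.level_iterate y i (by omega)
      have h2 := hf.level_iterate x (j - 1) (by omega)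
      have h3 := congrArg f hij
      omega
  -- Now `x` and its `k - 1` nearest ancestors lie above the level of `y`.
  · refine hno ⟨fun i => if i = 0 then y else p^[i - 1] x, fun i => p^[i] y,
      ?_, hf.isDipath y (by omega), by simp, ?_⟩
    · have := hcons (k - 1) (by omega) (fun i hi => by
        have := hf.level_iterate x i (by omega)
        omega)
      rwa [Nat.sub_add_cancel hk] at this
    · intro i hi j hj hj' hij
      have h1 := hf.level_iterate y j (by omega)
      have h3 := congrArg f hij
      dsimp only at h3
      split_ifs at h3 with hi0
      · omega
      · have h2 := hf.level_iterate x (i - 1) (by omega)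
        omega

/-! ### Three-block paths -/

/-- Three directed paths that fit together to a copy of `P(k, l, r)`. -/
theorem contains_threeBlockPath {D : Digraph V} {α β γ : ℕ → V} {k l r : ℕ}
    (hα : IsDipath (flip D.Adj) α k) (hβ : IsDipath (flip D.Adj) β l) (hγ : IsDipath D.Adj γ r)
    (hαβ : α 0 = β 0) (hβγ : β l = γ 0) (hdαβ : ∀ i ≤ k, ∀ j ≤ l, 1 ≤ j → α i ≠ β j)
    (hdαγ : ∀ i ≤ k, ∀ j ≤ r, 1 ≤ j → α i ≠ γ j)
    (hdβγ : ∀ i ≤ l, ∀ j ≤ r, 1 ≤ j → β i ≠ γ j) :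
    D.Contains (threeBlockPath k l r) := by
  let F : ℕ → V := fun i =>
    if i ≤ k then α (k - i) else if i ≤ k + l then β (i - k) else γ (i - k - l)
  have F1 : ∀ i ≤ k, F i = α (k - i) := fun i hi => if_pos hi
  have F2 : ∀ i, k ≤ i → i ≤ k + l → F i = β (i - k) := by
    intro i hi hi'
    rcases hi.eq_or_lt with rfl | hlt
    · simp [F, hαβ]
    · simp only [F, show ¬ i ≤ k by omega, hi', if_true, if_false]
  have F3 : ∀ i, k + l ≤ i → F i = γ (i - k - l) := by
    intro i hi
    rcases hi.eq_or_lt with rfl | hlt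
    · rw [F2 _ (by omega) le_rfl, show k + l - k = l by omega, hβγ, Nat.sub_self]
    · simp only [F, show ¬ i ≤ k by omega, show ¬ i ≤ k + l by omega, if_false]
  have hinj : ∀ i j, i < j → j ≤ k + l + r → F i ≠ F j := by
    intro i j hij hj hF
    rcases le_or_gt i k with hi1 | hi1
    · rw [F1 i hi1] at hF
      rcases le_or_gt j k with hj1 | hj1
      · rw [F1 j hj1] at hF
        have := hα.2 _ (by omega) _ (by omega) hF
        omega
      · rcases le_or_gt j (k + l) with hj2 | hj2
        · rw [F2 j hj1.le hj2] at hF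
          exact hdαβ _ (by omega) _ (by omega) (by omega) hF
        · rw [F3 j hj2.le] at hF
          exact hdαγ _ (by omega) _ (by omega) (by omega) hF
    · rcases le_or_gt i (k + l) with hi2 | hi2
      · rw [F2 i hi1.le hi2] at hF
        rcases le_or_gt j (k + l) with hj2 | hj2
        · rw [F2 j (by omega) hj2] at hF
          have := hβ.2 _ (by omega) _ (by omega) hF
          omega
        · rw [F3 j hj2.le] at hF
          exact hdβγ _ (by omega) _ (by omega) (by omega) hF
      · rw [F3 i hi2.le, F3 j (by omega)] at hF
        have := hγ.2 _ (by omega) _ (by omega) hF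
        omega
  refine ⟨fun i => F i, fun i j hij => ?_, ?_⟩
  · by_contra hne
    rcases lt_or_gt_of_ne (fun h => hne (Fin.ext h) : i.val ≠ j.val) with h | h
    · exact hinj i j h (by omega) hij
    · exact hinj j i h (by omega) hij.symm
  · rintro ⟨a, ha⟩ ⟨b, hb⟩ hab
    simp only [threeBlockPath] at hab
    rcases hab with ⟨rfl, h | h⟩ | ⟨rfl, h1, h2⟩
    · have := hα.1 (k - (a + 1)) (by omega)
      rw [show k - (a + 1) + 1 = k - a by omega] at this
      change D.Adj (F a) (F (a + 1))
      rw [F1 a (by omega), F1 (a + 1) (by omega)]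
      exact this
    · have := hγ.1 (a - k - l) (by omega)
      rw [show a - k - l + 1 = a + 1 - k - l by omega] at this
      change D.Adj (F a) (F (a + 1))
      rwa [F3 a (by omega), F3 (a + 1) (by omega)]
    · have := hβ.1 (b - k) (by omega)
      rw [show b - k + 1 = b + 1 - k by omega] at this
      change D.Adj (F (b + 1)) (F b)
      rw [F2 b (by omega) (by omega), F2 (b + 1) (by omega) (by omega)]
      exact this

/-- Take a maximal vertex set `Y` without directed paths of `k + r - 1` arcs. Every other vertex is
the end of a path of `k` arcs or the start of a path of `r` arcs whose other vertices are in `Y`,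
so that a two-block path outside `Y` extends to a three-block path. -/
theorem colorableOn_of_not_contains_threeBlockPath [Finite V] {D : Digraph V} (hD : D.IsSimple)
    {k l r : ℕ} (hk : 1 ≤ k) (hl : 1 ≤ l) (hr : 1 ≤ r)
    (hfree : ¬ D.Contains (threeBlockPath k l r)) :
    ColorableOn D.Adj Set.univ (2 * (k + l + r) + 1) := by
  have hirr : ∀ x, ¬ D.Adj x x := fun x hx => hD x x hx hx
  -- On a path with `k + r` vertices, each vertex has at least `k` predecessors or at least `r`
  -- successors.
  let m := k + r - 1
  obtain ⟨Y, -, hY⟩ := (Set.toFinite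
    {Y : Set V | ¬ ∃ γ, IsDipath D.Adj γ m ∧ ∀ i ≤ m, γ i ∈ Y}).exists_le_maximal
    (a := ∅) (by rintro ⟨γ, -, h⟩; exact h 0 (Nat.zero_le _))
  let Xout : Set V := {x | x ∉ Y ∧
    ∃ γ, IsDipath D.Adj γ r ∧ γ 0 = x ∧ ∀ i ≤ r, 1 ≤ i → γ i ∈ Y}
  let Xin : Set V := {x | x ∉ Y ∧
    ∃ α, IsDipath (flip D.Adj) α k ∧ α 0 = x ∧ ∀ i ≤ k, 1 ≤ i → α i ∈ Y}
  have hcover : (Set.univ : Set V) ⊆ Y ∪ (Xout ∪ Xin) := by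
    intro x _
    by_cases hx : x ∈ Y
    · exact Or.inl hx
    right
    have hnot : insert x Y ∉ {Y : Set V | ¬ ∃ γ, IsDipath D.Adj γ m ∧ ∀ i ≤ m, γ i ∈ Y} :=
      fun h => hx (hY.le_of_ge h (Set.subset_insert x Y) (Set.mem_insert x Y))
    simp only [Set.mem_ofPred_eq, not_not] at hnot
    obtain ⟨γ, hγ, hγY⟩ := hnot
    obtain ⟨i, him, hi⟩ : ∃ i ≤ m, γ i = x := by
      by_contra! hcon
      exact hY.prop ⟨γ, hγ, fun i hi => (hγY i hi).resolve_left (hcon i hi)⟩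
    have hmem : ∀ j ≤ m, j ≠ i → γ j ∈ Y := fun j hj hji =>
      (hγY j hj).resolve_left fun h => hji (hγ.2 j hj i him (h.trans hi.symm))
    by_cases hik : k ≤ i
    · exact Or.inr ⟨hx, fun j => γ (i - j), hγ.reverse him hik, hi,
        fun j hj hj' => hmem _ (by omega) (by omega)⟩
    · exact Or.inl ⟨hx, fun j => γ (i + j), hγ.shift (by omega), hi,
        fun j hj hj' => hmem _ (by omega) (by omega)⟩
  have hYcol : ColorableOn D.Adj Y m :=
    (colorableOn_or_exists_isDipath hirr Y m).resolve_right hY.prop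
  have hout : ColorableOn D.Adj Xout (l + (k + 1)) := by
    refine (colorableOn_or_exists_isSinkPair hirr Xout hk hl).resolve_right ?_
    rintro ⟨α, β, ⟨hα, hβ, h0, hd⟩, hαX, hβX⟩
    obtain ⟨-, γ, hγ, hγ0, hγY⟩ := hβX l le_rfl
    exact hfree (contains_threeBlockPath hα hβ hγ h0 hγ0.symm hd
      (fun i hi j hj hj' h => (hαX i hi).1 (h ▸ hγY j hj hj'))
      (fun i hi j hj hj' h => (hβX i hi).1 (h ▸ hγY j hj hj')))
  have hin : ColorableOn D.Adj Xin (l + (r + 1)) := by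
    refine ColorableOn.of_flip
      ((colorableOn_or_exists_isSinkPair (R := flip D.Adj) hirr Xin hr hl).resolve_right ?_)
    rintro ⟨γ, β, ⟨hγ, hβ, h0, hd⟩, hγX, hβX⟩
    obtain ⟨-, α, hα, hα0, hαY⟩ := hβX l le_rfl
    -- Reversing all arcs turns the sink pair into two paths with a common start, so `β` is read
    -- backwards and `α` is attached at its far end.
    refine hfree (contains_threeBlockPath (α := α) (β := fun i => β (l - i)) (γ := γ) hα
      (IsDipath.reverse hβ le_rfl le_rfl) hγ hα0 (by simp [h0]) ?_ ?_ ?_)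
    · intro i hi j hj hj' h
      rcases Nat.eq_zero_or_pos i with rfl | hi'
      · have := hβ.2 l le_rfl (l - j) (by omega) (hα0.symm.trans h)
        omega
      · exact (hβX (l - j) (by omega)).1 (h ▸ hαY i hi hi')
    · intro i hi j hj hj' h
      rcases Nat.eq_zero_or_pos i with rfl | hi'
      · exact hd j hj l le_rfl hl (h.symm.trans hα0)
      · exact (hγX j hj).1 (h ▸ hαY i hi hi')
    · intro i hi j hj hj' h
      rcases Nat.eq_zero_or_pos (l - i) with hli | hli
      · rw [hli, ← h0] at h
        have := hγ.2 0 (by omega) j hj h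
        omega
      · exact hd j hj (l - i) (by omega) hli h.symm
  -- The count is `(k + r - 1) + (l + k + 1) + (l + r + 1)`.
  obtain ⟨c, hc, hc'⟩ := hYcol.union (hout.union hin)
  refine ⟨c, fun v hv => (hc v (hcover hv)).trans_le (by omega), fun x hx y hy =>
    hc' x (hcover hx) y (hcover hy)⟩

/-- The finite case extends to infinite digraphs by the de Bruijn–Erdős theorem. -/
theorem colorable_of_not_contains_threeBlockPath {D : Digraph V} (hD : D.IsSimple)
    {k l r : ℕ} (hk : 1 ≤ k) (hl : 1 ≤ l) (hr : 1 ≤ r)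
    (hfree : ¬ D.Contains (threeBlockPath k l r)) :
    D.toSimpleGraphInclusive.Colorable (2 * (k + l + r) + 1) := by
  refine SimpleGraph.nonempty_hom_of_forall_finite_subgraph_hom fun G hG => Classical.choice ?_
  have : Finite G.verts := hG
  let E : Digraph G.verts := ⟨fun x y => D.Adj x y⟩
  obtain ⟨c, hc, hc'⟩ := colorableOn_of_not_contains_threeBlockPath (D := E)
    (fun u v => hD u v) hk hl hr (by
      rintro ⟨g, hg, hg'⟩
      exact hfree ⟨fun i => g i, Subtype.val_injective.comp hg, hg'⟩)
  refine ⟨⟨fun v => ⟨c v, hc v trivial⟩, fun {x y} hxy => ?_⟩⟩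
  have hadj : D.toSimpleGraphInclusive.Adj x y := G.adj_sub hxy
  intro h
  have h' : c x = c y := congrArg Fin.val h
  rcases hadj.2 with h1 | h1
  · exact hc' x trivial y trivial h1 h'
  · exact hc' y trivial x trivial h1 h'.symm

end OrientedPath

theorem theorem3p1 {V : Type*} (D : Digraph V) (hD : D.IsSimple) (n k l r : ℕ)
    (hk : 2 ≤ k) (hl : 2 ≤ l) (hr : 2 ≤ r) (hn : k + l + r = n - 1) (hkr : k ≤ r)
    (hfree : ¬ D.Contains (threeBlockPath k l r)) :
    (l ≤ k → D.chromaticNumber ≤ ((2 * (n - 1) + r : ℕ) : ℕ∞)) ∧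
    (k ≤ l ∧ l ≤ r → D.chromaticNumber ≤ ((2 * (n - 1) + l + r - k : ℕ) : ℕ∞)) ∧
    (r ≤ l → D.chromaticNumber ≤ ((2 * (n + l - 1) - k : ℕ) : ℕ∞)) := by
  have hcol := OrientedPath.colorable_of_not_contains_threeBlockPath hD
    (by omega : 1 ≤ k) (by omega : 1 ≤ l) (by omega : 1 ≤ r) hfree
  refine ⟨fun h => ?_, fun h => ?_, fun h => ?_⟩ <;>
  exact (hcol.mono (by omega)).chromaticNumber_le
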